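/- Let $H$ be a real Hilbert space. A function $g:H\to\mathbb{R}\cup\{+\infty\}$ belongs to $\Gamma_0(H)$ if it is proper, lower semicontinuous and convex; its Fenchel conjugate is $g^*(v)=\sup_{x\in H}\{\langle v,x\rangle-g(x)\}$ (defined likewise for $g:H\to\overline{\mathbb{R}}$), its subdifferential is $\partial g(x)=\{y\in H:\ \langle y,z-x\rangle\le g(z)-g(x)\ \forall z\in H\}$, and its epigraph is $\mathrm{Epi}(g)=\{(x,\lambda)\in H\times\mathbb{R}: g(x)\le\lambda\}$. A family $(S_\tau)_{\tau>0}$ of subsets of a Hilbert space is Mosco-convergent as $\tau\to0$ if every weak limit of a sequence $x_n\in S_{t_n}$ with $t_n>0$, $t_n\to0$, belongs to the inner limit of $(S_\tau)$, i.e. to the set of points $a$ such that for every sequence $t_n>0$, $t_n\to 0$, there is $x_n\to a$ (strongly) with $x_n\in S_{t_n}$ for all large $n$; the Mosco limit is then this inner limit. A family $(g_\tau)_{\tau>0}$ of functions $H\to\overline{\mathbb{R}}$ is M-convergent if $(\mathrm{Epi}(g_\tau))_{\tau>0}$ is Mosco-convergent in $H\times\mathbb{R}$, and its M-limit is the function whose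 epigraph is the Mosco limit. Let $f:\mathbb{R}_+\times H\to\mathbb{R}\cup\{+\infty\}$ be such that $f(t,\cdot)\in\Gamma_0(H)$ for all $t\ge0$, and write $f^*(t,\cdot)=(f(t,\cdot))^*$. If $f(t,x)\in\mathbb{R}$ for all $t\ge0$ and $v\in\partial (f(0,\cdot))(x)$, then $f$ is called twice epi-differentiable at $x$ for $v$ if the functions $$\Delta^2_\tau f(x|v)(w)=\frac{f(\tau,x+\tau w)-f(\tau,x)-\tau\langle v,w\rangle}{\tau^2},\qquad \tau>0,$$ are M-convergent as $\tau\to0$; their M-limit $d^2_e f(x|v):H\to\overline{\mathbb{R}}$ is the second epi-derivative of $f$ at $x$ for $v$. **Proposition.** Let $f$ be as above, let $x\in H$ with $f(t,x)\in\mathbb{R}$ for all $t\ge0$, let $v\in\partial (f(0,\cdot))(x)$, and suppose that $f^*(t,v)<+\infty$ for all $t\ge0$, so that $$\Phi(t)=f^*(t,v)+f(t,x)-\langle v,x\rangle,\qquad t\ge0,$$ is real-valued. Assume that $\Phi$ is twice differentiable at $t=0$ (as a function on $[0,\infty)$, derivatives at $0$ being one-sided) with $\Phi'(0)=0$. Then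 $f$ is twice epi-differentiable at $x$ for $v$ with $d^2_e f(x|v)\in\Gamma_0(H)$ if and only if $f^*$ is twice epi-differentiable at $v$ for $x$ with $d^2_e f^*(v|x)\in\Gamma_0(H)$. In that case $$\big(d^2_e f(x|v)\big)^* = d^2_e f^*(v|x)+\tfrac12\,\Phi''(0).$$ -/

import Mathlib

open Filter Topology Set
open scoped InnerProductSpace

noncomputable section

namespace EpiSens

section SetLimits

variable {E : Type*} [NormedAddCommGroup E]

/-- The sequence `t` consists of positive reals and converges to `0`. -/
def PosToZero (t : ℕ → ℝ) : Prop :=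
  (∀ n, 0 < t n) ∧ Tendsto t atTop (𝓝 0)

/-- Weak convergence `u n ⇀ a` of a sequence in a real normed space. -/
def WeakTendsto [NormedSpace ℝ E] (u : ℕ → E) (a : E) : Prop :=
  Tendsto (fun n => toWeakSpace ℝ E (u n)) atTop (𝓝 (toWeakSpace ℝ E a))

/-- The (strong) inner limit, as `τ → 0` with `τ > 0`, of a family of subsets. Only the values
`S τ` with `τ > 0` matter. -/
def innerLim (S : ℝ → Set E) : Set E :=
  {a | ∀ t : ℕ → ℝ, PosToZero t →
    ∃ u : ℕ → E, Tendsto u atTop (𝓝 a) ∧ ∃ N : ℕ, ∀ n ≥ N, u n ∈ S (t n)}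

/-- The weak outer limit, as `τ → 0` with `τ > 0`, of a family of subsets. -/
def weakOuterLim [NormedSpace ℝ E] (S : ℝ → Set E) : Set E :=
  {a | ∃ t : ℕ → ℝ, PosToZero t ∧ ∃ u : ℕ → E, WeakTendsto u a ∧ ∀ n, u n ∈ S (t n)}

/-- Mosco convergence of a family of subsets as `τ → 0`, `τ > 0`. When it holds, all the inner and
outer (strong and weak) limits coincide, and their common value, the Mosco limit, is
`innerLim S`. -/
def MoscoConverges [NormedSpace ℝ E] (S : ℝ → Set E) : Prop :=
  weakOuterLim S ⊆ innerLim S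

theorem mem_innerLim_of_approx {S : ℝ → Set E} {a : E}
    (h : ∀ ε > 0, ∃ b ∈ innerLim S, dist b a < ε) : a ∈ innerLim S := by
  intro t ht
  have key : ∀ ε > 0, ∀ᶠ n in atTop, ∃ y ∈ S (t n), dist y a < ε := by
    intro ε hε
    obtain ⟨b, hb, hba⟩ := h (ε / 2) (by positivity)
    obtain ⟨u, hu, N, hN⟩ := hb t ht
    filter_upwards [Metric.tendsto_nhds.1 hu (ε / 2) (by positivity), eventually_ge_atTop N]
      with n h1 h2
    refine ⟨u n, hN n h2, ?_⟩
    have := dist_triangle (u n) b a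
    linarith
  have hch : ∀ n, ∃ y : E, (S (t n)).Nonempty →
      y ∈ S (t n) ∧ dist a y < Metric.infDist a (S (t n)) + 1 / ((n : ℝ) + 1) := by
    intro n
    by_cases hne : (S (t n)).Nonempty
    · have hpos : (0 : ℝ) < 1 / ((n : ℝ) + 1) := by positivity
      obtain ⟨y, hy, hy'⟩ := (Metric.infDist_lt_iff hne).1
        (lt_add_of_pos_right (Metric.infDist a (S (t n))) hpos)
      exact ⟨y, fun _ => ⟨hy, hy'⟩⟩
    · exact ⟨a, fun h => absurd h hne⟩
  choose u hu using hch
  have hne : ∀ᶠ n in atTop, (S (t n)).Nonempty := by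
    filter_upwards [key 1 one_pos] with n hn
    obtain ⟨y, hy, -⟩ := hn
    exact ⟨y, hy⟩
  refine ⟨u, ?_, ?_⟩
  · rw [Metric.tendsto_nhds]
    intro ε hε
    have h0 := tendsto_one_div_add_atTop_nhds_zero_nat (𝕜 := ℝ)
    filter_upwards [key (ε / 2) (by positivity), hne,
      h0.eventually (gt_mem_nhds (show (0 : ℝ) < ε / 2 by positivity))] with n h1 h2 h3
    obtain ⟨y, hy, hya⟩ := h1
    have h4 := (hu n h2).2
    have h5 := Metric.infDist_le_dist_of_mem (x := a) hy
    rw [dist_comm] at hya h4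
    linarith
  · obtain ⟨N, hN⟩ := eventually_atTop.1 hne
    exact ⟨N, fun n hn => (hu n (hN n hn)).1⟩

end SetLimits

section Functions

variable {H : Type*} [NormedAddCommGroup H] [InnerProductSpace ℝ H]

/-- The epigraph of an extended-real-valued function, a subset of `H × ℝ`. -/
def epi (g : H → EReal) : Set (H × ℝ) :=
  {p | g p.1 ≤ (p.2 : EReal)}

/-- `g ∈ Γ₀(H)`: values in `ℝ ∪ {+∞}`, proper, lower semicontinuous (closed epigraph) and convex
(convex epigraph). -/
structure IsGammaZero (g : H → EReal) : Prop where
  ne_bot : ∀ w, g w ≠ ⊥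
  proper : ∃ w, g w ≠ ⊤
  closed_epi : IsClosed (epi g)
  convex_epi : Convex ℝ (epi g)

/-- M-convergence, as `τ → 0` with `τ > 0`, of a family of extended-real-valued functions. -/
def MConverges (F : ℝ → H → EReal) : Prop :=
  MoscoConverges fun τ => epi (F τ)

/-- The M-limit of a family of functions: the function whose epigraph is the Mosco limit of the
epigraphs (see `epi_mLim`). -/
def mLim (F : ℝ → H → EReal) : H → EReal := fun w =>
  sInf {c : EReal | ∃ r : ℝ, c = (r : EReal) ∧ (w, r) ∈ innerLim fun τ => epi (F τ)}

theorem epi_mLim (F : ℝ → H → EReal) :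
    epi (mLim F) = innerLim fun τ => epi (F τ) := by
  have up : ∀ (w : H) (r s : ℝ), r ≤ s → (w, r) ∈ innerLim (fun τ => epi (F τ)) →
      (w, s) ∈ innerLim (fun τ => epi (F τ)) := by
    intro w r s hrs h t ht
    obtain ⟨u, hu, N, hN⟩ := h t ht
    refine ⟨fun n => ((u n).1, (u n).2 + (s - r)), ?_, N, fun n hn => ?_⟩
    · have h1 : Tendsto (fun n => (u n).1) atTop (𝓝 w) := (continuous_fst.tendsto _).comp hu
      have h2 : Tendsto (fun n => (u n).2) atTop (𝓝 r) := (continuous_snd.tendsto _).comp hu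
      have h3 := h1.prodMk_nhds (h2.add_const (s - r))
      simpa using h3
    · have h4 : F (t n) (u n).1 ≤ (((u n).2 : ℝ) : EReal) := hN n hn
      refine le_trans h4 ?_
      exact EReal.coe_le_coe_iff.2 (by simpa using hrs)
  ext ⟨w, r⟩
  constructor
  · intro h
    apply mem_innerLim_of_approx
    intro ε hε
    have hlt : mLim F w < ((r + ε / 2 : ℝ) : EReal) :=
      lt_of_le_of_lt (show mLim F w ≤ (r : EReal) from h)
        (EReal.coe_lt_coe_iff.2 (by linarith))
    obtain ⟨c, ⟨s, rfl, hs⟩, hsr⟩ := sInf_lt_iff.1 hlt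
    refine ⟨(w, r + ε / 2), up w s _ (EReal.coe_lt_coe_iff.1 hsr).le hs, ?_⟩
    rw [Prod.dist_eq]
    simp only [dist_self, Real.dist_eq, add_sub_cancel_left, abs_of_pos (half_pos hε)]
    exact max_lt hε (half_lt_self hε)
  · intro h
    have h1 : mLim F w ≤ (r : EReal) := sInf_le ⟨r, rfl, h⟩
    exact h1

/-- The subdifferential `∂g(x)` of convex analysis. -/
def subdifferential (g : H → EReal) (x : H) : Set H :=
  {y | ∀ z, ((⟪y, z - x⟫_ℝ : ℝ) : EReal) ≤ g z - g x}

/-- The Fenchel conjugate `g*(v) = sup_x (⟨v, x⟩ - g(x))`. -/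
def conj (g : H → EReal) : H → EReal := fun v =>
  ⨆ x : H, (((⟪v, x⟫_ℝ : ℝ) : EReal) - g x)

/-! Parameterized functions are written as maps `ℝ → H → EReal`, but only the values at
parameters `t ≥ 0` are ever used. -/

/-- `f ∈ Γ₀(·, H)`: `f(t, ·) ∈ Γ₀(H)` for all `t ≥ 0`. -/
def IsParamGammaZero (f : ℝ → H → EReal) : Prop :=
  ∀ t, 0 ≤ t → IsGammaZero (f t)

/-- `f⁻¹(·, ℝ)`: the points `x` with `f(t, x) ∈ ℝ` for all `t ≥ 0`. -/
def finitePoints (f : ℝ → H → EReal) : Set H :=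
  {x | ∀ t, 0 ≤ t → f t x ≠ ⊥ ∧ f t x ≠ ⊤}

/-- The parameterized conjugate `f*(t, v) = (f(t, ·))*(v)`. -/
def paramConj (f : ℝ → H → EReal) : ℝ → H → EReal := fun t => conj (f t)

/-- The second-order difference quotient
`Δ²_τ f(x|v)(w) = (f(τ, x + τ w) - f(τ, x) - τ ⟨v, w⟩) / τ²`. -/
def secondQuotient (f : ℝ → H → EReal) (x v : H) (τ : ℝ) : H → EReal := fun w =>
  (f τ (x + τ • w) - f τ x - ((τ * ⟪v, w⟫_ℝ : ℝ) : EReal)) / ((τ ^ 2 : ℝ) : EReal)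

/-- `f` is twice epi-differentiable at `x` for `v` (this includes the requirements
`f ∈ Γ₀(·, H)`, `x ∈ f⁻¹(·, ℝ)` and `v ∈ ∂f(0, x)` under which the notion is defined). -/
structure TwiceEpiDifferentiableAt (f : ℝ → H → EReal) (x v : H) : Prop where
  gammaZero : IsParamGammaZero f
  finite_at : x ∈ finitePoints f
  mem_subdifferential : v ∈ subdifferential (f 0) x
  mConverges : MConverges (secondQuotient f x v)

/-- The second epi-derivative `d²_e f(x|v)`. -/
def secondEpiDeriv (f : ℝ → H → EReal) (x v : H) : H → EReal :=
  mLim (secondQuotient f x v)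

/-- The function `Φ(t) = f*(t, v) + f(t, x) - ⟨v, x⟩`, for `t ≥ 0`; the two extended-real terms
are meant to be finite. -/
def dualityGap (f : ℝ → H → EReal) (x v : H) : ℝ → ℝ := fun t =>
  (paramConj f t v).toReal + (f t x).toReal - ⟪v, x⟫_ℝ

end Functions

/-- A function on `[0, ∞)` is twice differentiable at `0`: it is differentiable on `[0, δ)` for
some `δ > 0` (one-sidedly at `0`), and its derivative is (one-sidedly) differentiable at `0`. -/
def TwiceDifferentiableAtZero (φ : ℝ → ℝ) : Prop :=
  (∀ᶠ t in 𝓝[≥] (0 : ℝ), DifferentiableWithinAt ℝ φ (Ici 0) t) ∧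
    DifferentiableWithinAt ℝ (derivWithin φ (Ici 0)) (Ici 0) 0

end EpiSens

end

open Filter Topology Set
open scoped InnerProductSpace

namespace EpiSens

/-! ### Weak convergence in normed spaces and in Hilbert spaces. -/

section WeakConvergence

variable {E : Type*} [NormedAddCommGroup E] [NormedSpace ℝ E]

/-! Everything is read on epigraphs, where conjugation becomes the operation `polarEpi`. The affine
change of variables defining the difference quotient turns conjugation into an exact identity
(`polarEpi_quotientEpi`): the conjugate of Δ²_τ f(x|v) is Δ²_τ f*(v|x) + Φ(τ)/τ².

Since v ∈ ∂f(0,·)(x), Fenchel–Young is an equality at t = 0, so Φ(0) = 0. With Φ'(0) = 0, Taylor's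
formula gives Φ(τ)/τ² → Φ''(0)/2 (`TwiceDifferentiableAtZero.tendsto_div_sq`). The two families of
quotients are therefore conjugate up to a convergent additive constant.

Mosco's theorem (`MoscoConverges.polarEpi`) says that conjugation preserves M-convergence and
commutes with the limit, and convergent vertical shifts are harmless
(`MoscoConverges.verticalShift`). The converse is the same argument after biconjugation
(`IsEpiLike.polarEpi_polarEpi`). Both Mosco's theorem and biconjugation rest on proximal points,
`IsEpiLike.exists_prox`. -/

theorem weakTendsto_iff {u : ℕ → E} {a : E} :
    WeakTendsto u a ↔ ∀ φ : E →L[ℝ] ℝ, Tendsto (fun n => φ (u n)) atTop (𝓝 (φ a)) := by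
  have hinj : Function.Injective (topDualPairing ℝ E).flip := by
    intro a b hab
    by_contra hne
    obtain ⟨φ, hφ⟩ := SeparatingDual.exists_separating_of_ne (R := ℝ) hne
    exact hφ (by simpa using LinearMap.congr_fun hab φ)
  exact WeakBilin.tendsto_iff_forall_eval_tendsto _ hinj

theorem WeakTendsto.of_tendsto {u : ℕ → E} {a : E} (h : Tendsto u atTop (𝓝 a)) :
    WeakTendsto u a :=
  weakTendsto_iff.2 fun φ => (φ.continuous.tendsto a).comp h

end WeakConvergence

section Hilbert

variable {H : Type*} [NormedAddCommGroup H] [InnerProductSpace ℝ H] [CompleteSpace H]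

theorem exists_inner_add_mul (φ : H × ℝ →L[ℝ] ℝ) :
    ∃ (a : H) (b : ℝ), ∀ (w : H) (s : ℝ), φ (w, s) = ⟪a, w⟫_ℝ + s * b := by
  refine ⟨(InnerProductSpace.toDual ℝ H).symm (φ.comp (ContinuousLinearMap.inl ℝ H ℝ)),
    φ (0, 1), fun w s => ?_⟩
  have h3 : ((w, s) : H × ℝ) = (w, 0) + s • (0, 1) := by simp
  rw [InnerProductSpace.toDual_symm_apply, h3, map_add, map_smul]
  rfl

theorem weakTendsto_prod_iff {u : ℕ → H} {r : ℕ → ℝ} {a : H} {b : ℝ} :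
    WeakTendsto (fun n => (u n, r n)) (a, b) ↔
      (∀ z : H, Tendsto (fun n => ⟪z, u n⟫_ℝ) atTop (𝓝 ⟪z, a⟫_ℝ)) ∧ Tendsto r atTop (𝓝 b) := by
  rw [weakTendsto_iff]
  constructor
  · intro h
    exact ⟨fun z => h ((innerSL ℝ z).comp (ContinuousLinearMap.fst ℝ H ℝ)),
      h (ContinuousLinearMap.snd ℝ H ℝ)⟩
  · rintro ⟨h1, h2⟩ φ
    obtain ⟨c, d, key⟩ := exists_inner_add_mul φ
    simp only [key]
    exact (h1 _).add (h2.mul_const _)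

/-- A weakly convergent sequence in a Hilbert space is bounded. -/
theorem exists_norm_le_of_weak {u : ℕ → H} {a : H}
    (h : ∀ z : H, Tendsto (fun n => ⟪z, u n⟫_ℝ) atTop (𝓝 ⟪z, a⟫_ℝ)) :
    ∃ M, ∀ n, ‖u n‖ ≤ M := by
  obtain ⟨C, hC⟩ := banach_steinhaus (g := fun n => innerSL ℝ (u n)) (fun z => by
    obtain ⟨M, hM⟩ := (Metric.isBounded_range_of_tendsto _ (h z)).exists_norm_le
    refine ⟨M, fun n => ?_⟩
    have := hM _ (mem_range_self n)
    rwa [real_inner_comm] at this)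
  exact ⟨C, fun n => by simpa using hC n⟩

/-- The inner product of a weakly and a strongly convergent sequence converges. -/
theorem tendsto_inner_of_weak_of_strong {u w : ℕ → H} {a b : H}
    (h : ∀ z : H, Tendsto (fun n => ⟪z, u n⟫_ℝ) atTop (𝓝 ⟪z, a⟫_ℝ))
    (hw : Tendsto w atTop (𝓝 b)) :
    Tendsto (fun n => ⟪u n, w n⟫_ℝ) atTop (𝓝 ⟪a, b⟫_ℝ) := by
  obtain ⟨M, hM⟩ := exists_norm_le_of_weak h
  have h1 : Tendsto (fun n => ⟪u n, w n - b⟫_ℝ) atTop (𝓝 0) := by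
    have h2 : Tendsto (fun n => M * ‖w n - b‖) atTop (𝓝 0) := by
      simpa using (tendsto_iff_norm_sub_tendsto_zero.1 hw).const_mul M
    refine squeeze_zero_norm (fun n => ?_) h2
    exact (norm_inner_le_norm _ _).trans (mul_le_mul_of_nonneg_right (hM n) (norm_nonneg _))
  have h3 := h1.add (h b)
  simp only [inner_sub_right, zero_add] at h3
  rw [real_inner_comm a b] at h3
  refine h3.congr fun n => ?_
  rw [real_inner_comm (u n) b]
  ring

/-- Bounded sequences in a Hilbert space have weakly convergent subsequences. -/
theorem exists_weak_subseq {u : ℕ → H} {M : ℝ} (hu : ∀ n, ‖u n‖ ≤ M) :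
    ∃ (a : H) (φ : ℕ → ℕ), StrictMono φ ∧
      ∀ z : H, Tendsto (fun n => ⟪z, u (φ n)⟫_ℝ) atTop (𝓝 ⟪z, a⟫_ℝ) := by
  -- `H` need not be separable, but the closed span of the sequence is; sequential Banach–Alaoglu
  -- applies there, and pairing with `z` sees only the projection of `z` onto `K`.
  set K : Submodule ℝ H := (Submodule.span ℝ (range u)).topologicalClosure with hK
  have huK : ∀ n, u n ∈ K := fun n =>
    Submodule.le_topologicalClosure _ (Submodule.subset_span (mem_range_self n))
  have : CompleteSpace K := (Submodule.isClosed_topologicalClosure _).completeSpace_coe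
  have : TopologicalSpace.SeparableSpace K := by
    have : TopologicalSpace.IsSeparable (K : Set H) := by
      rw [hK, Submodule.topologicalClosure_coe]
      exact ((countable_range u).isSeparable.span).closure
    exact this.separableSpace
  let U : ℕ → WeakDual ℝ K := fun n =>
    StrongDual.toWeakDual (InnerProductSpace.toDual ℝ K ⟨u n, huK n⟩)
  obtain ⟨ψ, -, φ, hφ, hlim⟩ := WeakDual.isSeqCompact_closedBall (𝕜 := ℝ) (E := K) 0 M
    (x := U) (fun n => by
      have h0 : ‖InnerProductSpace.toDual ℝ K ⟨u n, huK n⟩‖ ≤ M := by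
        rw [LinearIsometryEquiv.norm_map]
        exact hu n
      exact mem_closedBall_zero_iff.2 h0)
  refine ⟨((InnerProductSpace.toDual ℝ K).symm (WeakDual.toStrongDual ψ) : K), φ, hφ, fun z => ?_⟩
  have h1 : Tendsto (fun n => U (φ n) (K.orthogonalProjectionOnto z)) atTop
      (𝓝 (ψ (K.orthogonalProjectionOnto z))) :=
    ((WeakDual.eval_continuous (K.orthogonalProjectionOnto z)).tendsto ψ).comp hlim
  have h2 : ∀ k : K, ⟪z, (k : H)⟫_ℝ = ⟪k, K.orthogonalProjectionOnto z⟫_ℝ := by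
    intro k
    rw [real_inner_comm, Submodule.inner_orthogonalProjectionOnto_eq_of_mem_left]
  rw [h2, InnerProductSpace.toDual_symm_apply]
  refine h1.congr fun n => ?_
  exact (h2 ⟨u (φ n), huK (φ n)⟩).symm

end Hilbert

/-! ### Closed convex epigraphs: proximal points and Fenchel–Moreau. -/

section EpiLike

variable {H : Type*} [NormedAddCommGroup H] [InnerProductSpace ℝ H]

/-- The properties characterizing epigraphs of functions in `Γ₀(H)`. -/
structure IsEpiLike (C : Set (H × ℝ)) : Prop where
  isClosed : IsClosed C
  convex : Convex ℝ C
  nonempty : C.Nonempty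
  upward : ∀ {w : H} {r s : ℝ}, (w, r) ∈ C → r ≤ s → (w, s) ∈ C
  exists_notMem : ∀ w : H, ∃ r : ℝ, (w, r) ∉ C

/-- The epigraph of the conjugate of the function whose epigraph is `C`. -/
def polarEpi (C : Set (H × ℝ)) : Set (H × ℝ) :=
  {q | ∀ p ∈ C, ⟪q.1, p.1⟫_ℝ ≤ p.2 + q.2}

theorem nonneg_of_forall_add_mul {a b : ℝ} (h : ∀ θ : ℝ, 0 < θ → θ ≤ 1 → 0 ≤ a + θ * b) :
    0 ≤ a := by
  have h1 : Tendsto (fun θ : ℝ => a + θ * b) (𝓝[>] 0) (𝓝 a) := by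
    have : Tendsto (fun θ : ℝ => a + θ * b) (𝓝 0) (𝓝 (a + 0 * b)) :=
      (continuous_const.add (continuous_id.mul continuous_const)).tendsto 0
    rw [zero_mul, add_zero] at this
    exact this.mono_left nhdsWithin_le_nhds
  refine ge_of_tendsto h1 ?_
  filter_upwards [Ioc_mem_nhdsGT (zero_lt_one (α := ℝ))] with θ hθ
  exact h θ hθ.1 hθ.2

/-- The value at `p` of the quadratically penalized objective. -/
noncomputable def proxObjective (l : ℝ) (z : H) (p : H × ℝ) : ℝ :=
  p.2 + l / 2 * ‖p.1‖ ^ 2 - ⟪z, p.1⟫_ℝ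

theorem proxObjective_segment (l : ℝ) (z : H) (p q : H × ℝ) (θ : ℝ) :
    proxObjective l z (p + θ • (q - p)) = proxObjective l z p +
      θ * (q.2 - p.2 + l * ⟪p.1, q.1 - p.1⟫_ℝ - ⟪z, q.1 - p.1⟫_ℝ) +
      θ ^ 2 * (l / 2 * ‖q.1 - p.1‖ ^ 2) := by
  simp only [proxObjective, Prod.fst_add, Prod.snd_add, Prod.smul_fst, Prod.smul_snd,
    Prod.fst_sub, Prod.snd_sub, smul_eq_mul, norm_add_sq_real, inner_add_right,
    real_inner_smul_right, norm_smul, mul_pow, Real.norm_eq_abs, sq_abs]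
  ring

variable [CompleteSpace H] {C : Set (H × ℝ)}

theorem IsEpiLike.exists_affine_minorant (hC : IsEpiLike C) :
    ∃ (a : H) (b : ℝ), ∀ p ∈ C, ⟪a, p.1⟫_ℝ + b ≤ p.2 := by
  obtain ⟨⟨w₀, r₀⟩, h₀⟩ := hC.nonempty
  obtain ⟨r₁, h₁⟩ := hC.exists_notMem w₀
  obtain ⟨φ, u, hu, hφ⟩ := geometric_hahn_banach_point_closed hC.convex hC.isClosed h₁
  obtain ⟨a, b, key⟩ := exists_inner_add_mul φ
  have hr : r₁ < r₀ := by
    by_contra h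
    exact h₁ (hC.upward h₀ (not_lt.1 h))
  have h2 := hφ _ h₀
  rw [key] at hu h2
  -- The separated point `(w₀, r₁)` lies directly below `(w₀, r₀) ∈ C`, so the separating hyperplane
  -- cannot be vertical.
  have hb : 0 < b := by
    by_contra hb
    nlinarith [not_lt.1 hb]
  refine ⟨-(b⁻¹ • a), u / b, fun p hp => ?_⟩
  have h3 := hφ _ hp
  rw [← Prod.mk.eta (p := p), key] at h3
  rw [inner_neg_left, real_inner_smul_left]
  have h4 : -(b⁻¹ * ⟪a, p.1⟫_ℝ) + u / b = (u - ⟪a, p.1⟫_ℝ) / b := by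
    field_simp
    ring
  rw [h4, div_le_iff₀ hb]
  linarith

/-- The affine minorant and Young's inequality bound the objective below; strong convexity makes
minimizing sequences Cauchy, so no weak compactness is needed. -/
theorem IsEpiLike.exists_forall_proxObjective_le (hC : IsEpiLike C) {l : ℝ} (hl : 0 < l) (z : H) :
    ∃ p ∈ C, ∀ q ∈ C, proxObjective l z p ≤ proxObjective l z q := by
  obtain ⟨a, b, hab⟩ := hC.exists_affine_minorant
  have hbdd : BddBelow (proxObjective l z '' C) := by
    refine ⟨b - ‖z - a‖ ^ 2 / (2 * l), ?_⟩
    rintro _ ⟨p, hp, rfl⟩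
    have h1 := hab p hp
    have h2 := real_inner_le_norm (z - a) p.1
    rw [inner_sub_left] at h2
    have h3 : ‖z - a‖ * ‖p.1‖ ≤ ‖z - a‖ ^ 2 / (2 * l) + l / 2 * ‖p.1‖ ^ 2 := by
      have h4 : ‖z - a‖ ^ 2 / (2 * l) + l / 2 * ‖p.1‖ ^ 2 - ‖z - a‖ * ‖p.1‖ =
          (‖z - a‖ - l * ‖p.1‖) ^ 2 / (2 * l) := by
        field_simp
        ring
      have h5 : 0 ≤ (‖z - a‖ - l * ‖p.1‖) ^ 2 / (2 * l) := by positivity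
      linarith
    simp only [proxObjective]
    linarith
  set m := sInf (proxObjective l z '' C) with hm
  have hle : ∀ q ∈ C, m ≤ proxObjective l z q := fun q hq => csInf_le hbdd ⟨q, hq, rfl⟩
  have hseq : ∀ n : ℕ, ∃ p ∈ C, proxObjective l z p < m + 1 / ((n : ℝ) + 1) := by
    intro n
    have hpos : (0 : ℝ) < 1 / ((n : ℝ) + 1) := by positivity
    obtain ⟨_, ⟨p, hp, rfl⟩, h⟩ :=
      exists_lt_of_csInf_lt (hC.nonempty.image (proxObjective l z)) (lt_add_of_pos_right m hpos)
    exact ⟨p, hp, h⟩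
  choose p hpC hpm using hseq
  have hlim0 := tendsto_one_div_add_atTop_nhds_zero_nat (𝕜 := ℝ)
  -- Compare `m` with the objective at the midpoint of `q` and `q'`, where the quadratic term gains
  -- `l / 8 * ‖q'.1 - q.1‖ ^ 2` over the average.
  have hmid : ∀ q ∈ C, ∀ q' ∈ C,
      l / 8 * ‖q'.1 - q.1‖ ^ 2 ≤ (proxObjective l z q + proxObjective l z q') / 2 - m := by
    intro q hq q' hq'
    have h1 := hle _ (hC.convex.add_smul_sub_mem hq hq' (t := 1 / 2) (by norm_num))
    have h2 := proxObjective_segment l z q q' 1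
    rw [one_smul, add_sub_cancel] at h2
    rw [proxObjective_segment] at h1
    linarith
  have hcauchy : CauchySeq fun n => (p n).1 := by
    refine cauchySeq_of_le_tendsto_0 (fun N : ℕ => √(8 / l * (1 / ((N : ℝ) + 1))))
      (fun n k N hn hk => ?_) ?_
    · rw [dist_eq_norm]
      apply Real.le_sqrt_of_sq_le
      have h1 := hmid _ (hpC k) _ (hpC n)
      have h2 := (hpm n).le.trans (add_le_add_right (Nat.one_div_le_one_div (α := ℝ) hn) m)
      have h3 := (hpm k).le.trans (add_le_add_right (Nat.one_div_le_one_div (α := ℝ) hk) m)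
      have h4 : l / 8 * ‖(p n).1 - (p k).1‖ ^ 2 ≤ 1 / ((N : ℝ) + 1) := by linarith
      calc ‖(p n).1 - (p k).1‖ ^ 2 = 8 / l * (l / 8 * ‖(p n).1 - (p k).1‖ ^ 2) := by
            field_simp
        _ ≤ _ := mul_le_mul_of_nonneg_left h4 (by positivity)
    · have h1 := (hlim0.const_mul (8 / l)).sqrt
      simpa using h1
  obtain ⟨w, hw⟩ := cauchySeq_tendsto_of_complete hcauchy
  have hJ : Tendsto (fun n => proxObjective l z (p n)) atTop (𝓝 m) := by
    have h1 : Tendsto (fun n : ℕ => m + 1 / ((n : ℝ) + 1)) atTop (𝓝 m) := by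
      simpa using hlim0.const_add m
    exact tendsto_of_tendsto_of_tendsto_of_le_of_le tendsto_const_nhds h1
      (fun n => hle _ (hpC n)) (fun n => (hpm n).le)
  -- The heights converge because the objective and the first components do.
  have hr : Tendsto (fun n => (p n).2) atTop (𝓝 (m - l / 2 * ‖w‖ ^ 2 + ⟪z, w⟫_ℝ)) := by
    have h1 := (hJ.sub ((hw.norm.pow 2).const_mul (l / 2))).add
      (tendsto_const_nhds (x := z) |>.inner hw)
    refine h1.congr fun n => ?_
    simp only [proxObjective]
    ring
  refine ⟨(w, m - l / 2 * ‖w‖ ^ 2 + ⟪z, w⟫_ℝ),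
    hC.isClosed.mem_of_tendsto (hw.prodMk_nhds hr) (Eventually.of_forall hpC), fun q hq => ?_⟩
  refine le_trans (le_of_eq ?_) (hle q hq)
  simp only [proxObjective]
  ring

/-- Existence of proximal points, with the optimality condition in conjugate form. -/
theorem IsEpiLike.exists_prox (hC : IsEpiLike C) {l : ℝ} (hl : 0 < l) (z : H) :
    ∃ p ∈ C, (z - l • p.1, ⟪z - l • p.1, p.1⟫_ℝ - p.2) ∈ polarEpi C := by
  obtain ⟨p, hp, hmin⟩ := hC.exists_forall_proxObjective_le hl z
  refine ⟨p, hp, fun q hq => ?_⟩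
  have h : 0 ≤ q.2 - p.2 + l * ⟪p.1, q.1 - p.1⟫_ℝ - ⟪z, q.1 - p.1⟫_ℝ := by
    -- First-order optimality: move from `p` towards `q` by a fraction `θ`, divide by `θ`, and let
    -- `θ → 0`.
    refine nonneg_of_forall_add_mul (b := l / 2 * ‖q.1 - p.1‖ ^ 2) fun θ hθ hθ1 => ?_
    have h1 := hmin _ (hC.convex.add_smul_sub_mem hp hq (t := θ) ⟨hθ.le, hθ1⟩)
    rw [proxObjective_segment] at h1
    refine nonneg_of_mul_nonneg_right (a := θ) ?_ hθ
    linarith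
  simp only [inner_sub_left, inner_sub_right, real_inner_smul_left] at h ⊢
  linarith

theorem IsEpiLike.polarEpi (hC : IsEpiLike C) : IsEpiLike (polarEpi C) where
  isClosed := by
    have : EpiSens.polarEpi C = ⋂ p ∈ C, {q : H × ℝ | ⟪q.1, p.1⟫_ℝ ≤ p.2 + q.2} := by
      ext q
      simp [EpiSens.polarEpi]
    rw [this]
    exact isClosed_biInter fun p _ => isClosed_le (by fun_prop) (by fun_prop)
  convex := by
    intro q hq q' hq' a b ha hb hab p hp
    have h1 := mul_le_mul_of_nonneg_left (hq p hp) ha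
    have h2 := mul_le_mul_of_nonneg_left (hq' p hp) hb
    simp only [Prod.fst_add, Prod.smul_fst, Prod.snd_add, Prod.smul_snd, inner_add_left,
      real_inner_smul_left, smul_eq_mul]
    calc _ ≤ _ := add_le_add h1 h2
      _ = (a + b) * p.2 + (a * q.2 + b * q'.2) := by ring
      _ = _ := by rw [hab, one_mul]
  nonempty := by
    obtain ⟨p, -, h⟩ := hC.exists_prox one_pos 0
    exact ⟨_, h⟩
  upward := fun h hrs p hp => (h p hp).trans (by simpa using hrs)
  exists_notMem := by
    intro w
    obtain ⟨p, hp⟩ := hC.nonempty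
    refine ⟨⟪w, p.1⟫_ℝ - p.2 - 1, fun h => ?_⟩
    have := h p hp
    simp only at this
    linarith

/-- The Fenchel–Moreau theorem, in terms of epigraphs. -/
theorem IsEpiLike.polarEpi_polarEpi (hC : IsEpiLike C) :
    EpiSens.polarEpi (EpiSens.polarEpi C) = C := by
  refine Subset.antisymm ?_ fun p hp q hq => ?_
  · rintro ⟨x, r⟩ hxr
    obtain ⟨a, b, hab⟩ := hC.exists_affine_minorant
    -- With linear term `l • x`, completing the square shows that `p n` is the proximal point of `x`
    -- with penalty `l = n + 2`; these points tend to `x`. One unit of the penalty is spent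
    -- absorbing `‖x - (p n).1‖ ^ 2` in `hdist`, which leaves `n + 1`.
    have hprox := fun n : ℕ => hC.exists_prox (l := (n : ℝ) + 2) (by positivity)
      (((n : ℝ) + 2) • x)
    choose p hpC hpol using hprox
    have hbound : ∀ n : ℕ, p n ∈ C ∧ (p n).2 + ((n : ℝ) + 2) * ‖x - (p n).1‖ ^ 2 ≤ r := by
      intro n
      refine ⟨hpC n, ?_⟩
      have h1 := hxr _ (hpol n)
      simp only [← smul_sub, real_inner_smul_left, real_inner_smul_right] at h1
      have h2 : ⟪x, x - (p n).1⟫_ℝ = ‖x - (p n).1‖ ^ 2 + ⟪x - (p n).1, (p n).1⟫_ℝ := by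
        rw [← real_inner_self_eq_norm_sq, real_inner_comm (p n).1 (x - (p n).1), ← inner_add_left,
          sub_add_cancel]
      rw [h2] at h1
      linarith
    set K := r - b - ⟪a, x⟫_ℝ + ‖a‖ ^ 2 with hK
    have hdist : ∀ n : ℕ, ‖x - (p n).1‖ ^ 2 ≤ K * (1 / ((n : ℝ) + 1)) := by
      intro n
      have h1 := hab _ (hpC n)
      have h2 := (hbound n).2
      have h3 := real_inner_le_norm a (x - (p n).1)
      rw [inner_sub_right] at h3
      rw [mul_one_div, le_div_iff₀ (by positivity)]
      nlinarith [sq_nonneg (‖a‖ - ‖x - (p n).1‖), sq_nonneg ‖a‖, sq_nonneg ‖x - (p n).1‖]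
    have hw : Tendsto (fun n => (p n).1) atTop (𝓝 x) := by
      rw [tendsto_iff_norm_sub_tendsto_zero]
      have h1 := ((tendsto_one_div_add_atTop_nhds_zero_nat (𝕜 := ℝ)).const_mul K).sqrt
      rw [mul_zero, Real.sqrt_zero] at h1
      refine squeeze_zero (fun n => norm_nonneg _) (fun n => ?_) h1
      rw [norm_sub_rev]
      exact Real.le_sqrt_of_sq_le (hdist n)
    refine hC.isClosed.mem_of_tendsto (hw.prodMk_nhds (tendsto_const_nhds (x := r)))
      (Eventually.of_forall fun n => hC.upward (r := (p n).2) (hpC n) ?_)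
    have := (hbound n).2
    have h4 : 0 ≤ ((n : ℝ) + 2) * ‖x - (p n).1‖ ^ 2 := by positivity
    linarith
  · have := hq p hp
    rw [real_inner_comm] at this
    linarith

end EpiLike

/-! ### Inner limits of families of sets. -/

section InnerLimit

variable {E : Type*} [NormedAddCommGroup E]

/-- Taking points of `S (t n)` within `1 / (n + 1)` of the infimal distance to `a` gives one
sequence that works for every `ε`. -/
theorem mem_innerLim_of_eventually {S : ℝ → Set E} {a : E}
    (h : ∀ t, PosToZero t → ∀ ε > 0, ∀ᶠ n in atTop, ∃ y ∈ S (t n), dist y a < ε) :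
    a ∈ innerLim S := by
  intro t ht
  have hch : ∀ n, ∃ y : E, (S (t n)).Nonempty →
      y ∈ S (t n) ∧ dist a y < Metric.infDist a (S (t n)) + 1 / ((n : ℝ) + 1) := by
    intro n
    by_cases hne : (S (t n)).Nonempty
    · have hpos : (0 : ℝ) < 1 / ((n : ℝ) + 1) := by positivity
      obtain ⟨y, hy, hy'⟩ := (Metric.infDist_lt_iff hne).1
        (lt_add_of_pos_right (Metric.infDist a (S (t n))) hpos)
      exact ⟨y, fun _ => ⟨hy, hy'⟩⟩
    · exact ⟨a, fun h => absurd h hne⟩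
  choose u hu using hch
  refine ⟨u, ?_, ?_⟩
  · rw [Metric.tendsto_nhds]
    intro ε hε
    have h0 := tendsto_one_div_add_atTop_nhds_zero_nat (𝕜 := ℝ)
    filter_upwards [h t ht (ε / 2) (by positivity),
      h0.eventually (gt_mem_nhds (show (0 : ℝ) < ε / 2 by positivity))] with n h1 h2
    obtain ⟨y, hy, hya⟩ := h1
    have h4 := (hu n ⟨y, hy⟩).2
    have h5 := Metric.infDist_le_dist_of_mem (x := a) hy
    rw [dist_comm] at hya h4
    linarith
  · obtain ⟨N, hN⟩ := eventually_atTop.1 (h t ht 1 one_pos)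
    refine ⟨N, fun n hn => ?_⟩
    obtain ⟨y, hy, -⟩ := hN n hn
    exact (hu n ⟨y, hy⟩).1

theorem PosToZero.comp {t : ℕ → ℝ} (ht : PosToZero t) {φ : ℕ → ℕ} (hφ : StrictMono φ) :
    PosToZero (t ∘ φ) :=
  ⟨fun n => ht.1 (φ n), ht.2.comp hφ.tendsto_atTop⟩

theorem exists_posToZero : ∃ t, PosToZero t :=
  ⟨fun n => 1 / ((n : ℝ) + 1), fun _ => by positivity, tendsto_one_div_add_atTop_nhds_zero_nat⟩

theorem innerLim_subset_weakOuterLim [NormedSpace ℝ E] (S : ℝ → Set E) :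
    innerLim S ⊆ weakOuterLim S := by
  intro a ha
  obtain ⟨t, ht⟩ := exists_posToZero
  obtain ⟨u, hu, N, hN⟩ := ha t ht
  have hφ : StrictMono fun n : ℕ => n + N := fun _ _ h => by simpa using h
  exact ⟨t ∘ fun n => n + N, ht.comp hφ, u ∘ fun n => n + N,
    WeakTendsto.of_tendsto (hu.comp hφ.tendsto_atTop), fun n => hN _ (Nat.le_add_left N n)⟩

end InnerLimit

/-! ### Mosco's theorem on conjugation. -/

section Mosco

variable {H : Type*} [NormedAddCommGroup H] [InnerProductSpace ℝ H] [CompleteSpace H]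
  {C : ℝ → Set (H × ℝ)}

/-- The easy half: the polar inequality pairs a weakly convergent sequence with a strongly
convergent one, so it passes to the limit for arbitrary sets. -/
theorem weakOuterLim_polarEpi_subset (C : ℝ → Set (H × ℝ)) :
    weakOuterLim (fun τ => polarEpi (C τ)) ⊆ polarEpi (innerLim C) := by
  rintro ⟨z, s⟩ ⟨t, ht, u, hu, hmem⟩ p hp
  obtain ⟨y, hy, N, hN⟩ := hp t ht
  obtain ⟨h1, h2⟩ := (weakTendsto_prod_iff (u := fun n => (u n).1) (r := fun n => (u n).2)).1 hu
  refine le_of_tendsto_of_tendsto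
    (tendsto_inner_of_weak_of_strong h1 ((continuous_fst.tendsto p).comp hy))
    (((continuous_snd.tendsto p).comp hy).add h2) ?_
  filter_upwards [eventually_ge_atTop N] with n hn
  exact hmem n _ (hN n hn)

/-- Along bounded sequences, a minorant of the Mosco limit is an asymptotic minorant. -/
theorem MoscoConverges.eventually_le_of_bounded (hM : MoscoConverges C)
    (hC : ∀ τ, 0 < τ → IsEpiLike (C τ)) {z : H} {s : ℝ} (hz : (z, s) ∈ polarEpi (innerLim C))
    {t : ℕ → ℝ} (ht : PosToZero t) {v : ℕ → H × ℝ} {M : ℝ}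
    (hv : ∀ᶠ n in atTop, v n ∈ C (t n) ∧ ‖(v n).1‖ ≤ M) {ε : ℝ} (hε : 0 < ε) :
    ∀ᶠ n in atTop, ⟪z, (v n).1⟫_ℝ - s - ε ≤ (v n).2 := by
  by_contra hcon
  obtain ⟨φ, hφ, hP⟩ := extraction_of_frequently_atTop
    ((not_eventually.1 hcon).and_eventually hv)
  obtain ⟨a, ψ, hψ, hlim⟩ := exists_weak_subseq (u := fun n => (v (φ n)).1)
    (fun n => (hP n).2.2)
  -- Where the bound fails, upward closure puts the point at height `⟪z, ·⟫ - s - ε` in the set; its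
  -- weak limit then lies in the Mosco limit and violates `hz` by `ε`.
  have hmem : (a, ⟪z, a⟫_ℝ - s - ε) ∈ innerLim C := by
    refine hM ⟨t ∘ (φ ∘ ψ), ht.comp (hφ.comp hψ),
      fun n => ((v (φ (ψ n))).1, ⟪z, (v (φ (ψ n))).1⟫_ℝ - s - ε),
      weakTendsto_prod_iff.2 ⟨hlim, ((hlim z).sub_const s).sub_const ε⟩, fun n => ?_⟩
    exact (hC _ (ht.1 _)).upward (hP (ψ n)).2.1 (not_le.1 (hP (ψ n)).1).le
  have := hz _ hmem
  simp only at this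
  linarith

/-- Proximal points of a Mosco-convergent sequence are bounded. -/
theorem MoscoConverges.exists_norm_prox_le (hM : MoscoConverges C)
    (hC : ∀ τ, 0 < τ → IsEpiLike (C τ)) {z : H} {s : ℝ} (hz : (z, s) ∈ polarEpi (innerLim C))
    {t : ℕ → ℝ} (ht : PosToZero t) {y : ℕ → H × ℝ} {B R : ℝ}
    (hy : ∀ᶠ n in atTop, y n ∈ C (t n) ∧ ‖(y n).1‖ ≤ B ∧ (y n).2 ≤ R) {l : ℝ} (hl : 0 < l)
    {p : ℕ → H × ℝ} (hp : ∀ n, p n ∈ C (t n))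
    (hpol : ∀ n, (z - l • (p n).1, ⟪z - l • (p n).1, (p n).1⟫_ℝ - (p n).2) ∈ polarEpi (C (t n))) :
    ∃ M, ∀ᶠ n in atTop, ‖(p n).1‖ ≤ M := by
  set D : ℕ → ℝ := fun n => ‖(p n).1 - (y n).1‖ with hD
  have hmax : ∀ n, 0 < max 1 (D n) := fun n => lt_max_of_lt_left one_pos
  -- A point of the segment from `y n` to `p n`, at horizontal distance at most 1 from `y n`. Its
  -- asymptotic lower bound spreads by convexity to a bound on `(y n).2 - (p n).2` linear in `max 1
  -- (D n)`. The proximal inequality bounds the opposite difference by `M₂ * D n - l * D n ^ 2`, and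
  -- adding the two bounds `D n`.
  set v : ℕ → H × ℝ := fun n => y n + (max 1 (D n))⁻¹ • (p n - y n) with hvdef
  have hv : ∀ᶠ n in atTop, v n ∈ C (t n) ∧ ‖(v n).1‖ ≤ B + 1 := by
    filter_upwards [hy] with n hn
    refine ⟨(hC _ (ht.1 n)).convex.add_smul_sub_mem hn.1 (hp n)
      ⟨(inv_pos.2 (hmax n)).le, inv_le_one_of_one_le₀ (le_max_left _ _)⟩, ?_⟩
    refine (norm_add_le _ _).trans (add_le_add hn.2.1 ?_)
    rw [Prod.smul_fst, norm_smul, norm_inv, Real.norm_of_nonneg (hmax n).le, inv_mul_le_iff₀ (hmax n),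
      mul_one]
    exact le_max_right _ _
  have hlow := hM.eventually_le_of_bounded hC hz ht hv one_pos
  set M₁ := R + s + 1 + ‖z‖ * (B + 1) with hM₁
  set M₂ := ‖z‖ + l * B with hM₂
  refine ⟨B + max 1 ((|M₁| + M₂) / l), ?_⟩
  filter_upwards [hy, hv, hlow] with n h1 h2 h3
  have hDn : 0 ≤ D n := norm_nonneg _
  have h4 : (y n).2 - (p n).2 ≤ |M₁| * max 1 (D n) := by
    have h5 := (abs_le.1 ((abs_real_inner_le_norm z (v n).1).trans
      (mul_le_mul_of_nonneg_left h2.2 (norm_nonneg z)))).1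
    have h6 : (v n).2 = (y n).2 + (max 1 (D n))⁻¹ * ((p n).2 - (y n).2) := rfl
    rw [h6] at h3
    have h7 : (max 1 (D n))⁻¹ * ((y n).2 - (p n).2) ≤ M₁ := by
      rw [hM₁]
      linarith [h1.2.2]
    rw [inv_mul_le_iff₀ (hmax n), mul_comm] at h7
    exact h7.trans (mul_le_mul_of_nonneg_right (le_abs_self _) (hmax n).le)
  have h5 : (p n).2 - (y n).2 ≤ M₂ * D n - l * D n ^ 2 := by
    have h6 := hpol n _ h1.1
    have h7 : ⟪z - l • (p n).1, (p n).1⟫_ℝ - ⟪z - l • (p n).1, (y n).1⟫_ℝ =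
        ⟪z - l • (y n).1, (p n).1 - (y n).1⟫_ℝ - l * D n ^ 2 := by
      rw [hD, ← real_inner_self_eq_norm_sq, ← inner_sub_right, ← real_inner_smul_left,
        ← inner_sub_left]
      congr 1
      module
    have h8 : ⟪z - l • (y n).1, (p n).1 - (y n).1⟫_ℝ ≤ M₂ * D n := by
      refine (real_inner_le_norm _ _).trans (mul_le_mul_of_nonneg_right ?_ hDn)
      refine (norm_sub_le _ _).trans ?_
      rw [norm_smul, Real.norm_of_nonneg hl.le, hM₂]
      gcongr
      exact h1.2.1
    simp only at h6
    linarith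
  have h6 : D n ≤ max 1 ((|M₁| + M₂) / l) := by
    rcases le_total (D n) 1 with h | h
    · exact h.trans (le_max_left _ _)
    · refine le_trans ?_ (le_max_right _ _)
      rw [max_eq_right h] at h4
      rw [le_div_iff₀ hl]
      have h7 : D n * (D n * l) ≤ D n * (|M₁| + M₂) := by nlinarith
      exact le_of_mul_le_mul_left h7 (by linarith)
  calc ‖(p n).1‖ = ‖(y n).1 + ((p n).1 - (y n).1)‖ := by rw [add_sub_cancel]
    _ ≤ _ := (norm_add_le _ _).trans (add_le_add h1.2.1 h6)

/-- The hard half. Proximal points `p n` with a small fixed penalty `l` yield slopes `z - l • (p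
n).1` in the domain of the conjugates; boundedness of `p n` lets `hM` control the heights, and `l *
‖(p n).1‖` stays below `ε`. -/
theorem MoscoConverges.polarEpi_innerLim_subset (hM : MoscoConverges C)
    (hC : ∀ τ, 0 < τ → IsEpiLike (C τ)) (hne : (innerLim C).Nonempty) :
    polarEpi (innerLim C) ⊆ innerLim (fun τ => polarEpi (C τ)) := by
  rintro ⟨z, s⟩ hz
  refine mem_innerLim_of_eventually fun t ht ε hε => ?_
  obtain ⟨p₀, hp₀⟩ := hne
  obtain ⟨y, hy, N, hN⟩ := hp₀ t ht
  set B := ‖p₀.1‖ + 1 with hB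
  set R := p₀.2 + 1 with hR
  have hBpos : 0 < B := by positivity
  have hyb : ∀ᶠ n in atTop, y n ∈ C (t n) ∧ ‖(y n).1‖ ≤ B ∧ (y n).2 ≤ R := by
    have h1 : Tendsto (fun n => ‖(y n).1‖) atTop (𝓝 ‖p₀.1‖) :=
      ((continuous_fst.tendsto p₀).comp hy).norm
    have h2 : Tendsto (fun n => (y n).2) atTop (𝓝 p₀.2) := (continuous_snd.tendsto p₀).comp hy
    filter_upwards [eventually_ge_atTop N, h1.eventually (gt_mem_nhds (lt_add_one _)),
      h2.eventually (gt_mem_nhds (lt_add_one _))] with n h3 h4 h5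
    exact ⟨hN n h3, h4.le, h5.le⟩
  set A := |s + ε + R + ‖z‖ * B| with hA
  -- Chosen so that `l * (A / ε + B) = ε / 2`. With `X = l * ‖(p n).1‖`, the estimate `X * X ≤ l *
  -- (A + X * B)` then excludes `X ≥ ε`, since it would give `X ≤ ε / 2`.
  set l := ε / (2 * (A / ε + B)) with hl'
  have hApos : 0 ≤ A := abs_nonneg _
  have hl : 0 < l := by positivity
  choose p hp hpol using fun n => (hC (t n) (ht.1 n)).exists_prox hl z
  obtain ⟨M, hMb⟩ := hM.exists_norm_prox_le hC hz ht hyb hl hp hpol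
  have hlow := hM.eventually_le_of_bounded hC hz ht
    (hMb.mono fun n hn => (⟨hp n, hn⟩ : p n ∈ C (t n) ∧ ‖(p n).1‖ ≤ M)) (half_pos hε)
  filter_upwards [hyb, hlow] with n h1 h2
  have hsq : ⟪z - l • (p n).1, (p n).1⟫_ℝ = ⟪z, (p n).1⟫_ℝ - l * ‖(p n).1‖ ^ 2 := by
    rw [inner_sub_left, real_inner_smul_left, real_inner_self_eq_norm_sq]
  refine ⟨(z - l • (p n).1, s + ε / 2), (hC _ (ht.1 n)).polarEpi.upward (hpol n) ?_, ?_⟩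
  · have : 0 ≤ l * ‖(p n).1‖ ^ 2 := by positivity
    linarith
  · have h3 := hpol n _ h1.1
    have h4 := (abs_le.1 ((abs_real_inner_le_norm z (y n).1).trans
      (mul_le_mul_of_nonneg_left h1.2.1 (norm_nonneg z)))).1
    have h5 : ⟪(p n).1, (y n).1⟫_ℝ ≤ ‖(p n).1‖ * B :=
      (real_inner_le_norm _ _).trans (mul_le_mul_of_nonneg_left h1.2.1 (norm_nonneg _))
    simp only [hsq] at h3
    rw [inner_sub_left, real_inner_smul_left] at h3
    set X := l * ‖(p n).1‖ with hX
    have hX0 : 0 ≤ X := by positivity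
    have h6 : l * ‖(p n).1‖ ^ 2 ≤ A + X * B := by
      have h7 := le_abs_self (s + ε + R + ‖z‖ * B)
      have h8 := mul_le_mul_of_nonneg_left h5 hl.le
      rw [← mul_assoc] at h8
      linarith [h1.2.2]
    have h7 : X * X ≤ l * (A + X * B) := by
      have := mul_le_mul_of_nonneg_left h6 hl.le
      calc X * X = l * (l * ‖(p n).1‖ ^ 2) := by rw [hX]; ring
        _ ≤ _ := this
    have h8 : X < ε := by
      by_contra hcon
      have hcon := not_lt.1 hcon
      have h9 : A + X * B ≤ X * (A / ε + B) := by
        have : A ≤ X * (A / ε) := by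
          rw [mul_div_assoc', le_div_iff₀ hε, mul_comm X]
          exact mul_le_mul_of_nonneg_left hcon hApos
        linarith
      have h10 : l * (A / ε + B) = ε / 2 := by
        rw [hl']
        field_simp
      have h11 : X * X ≤ X * (ε / 2) := by
        refine h7.trans ((mul_le_mul_of_nonneg_left h9 hl.le).trans (le_of_eq ?_))
        rw [← h10]
        ring
      have h12 := le_of_mul_le_mul_left h11 (by linarith)
      linarith
    rw [Prod.dist_eq]
    refine max_lt ?_ ?_
    · simpa [dist_eq_norm, norm_smul, abs_of_pos hl] using h8
    · simp only [Real.dist_eq, add_sub_cancel_left, abs_of_pos (half_pos hε)]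
      linarith

/-- Mosco's theorem: conjugation is continuous for Mosco convergence. -/
theorem MoscoConverges.polarEpi (hM : MoscoConverges C)
    (hC : ∀ τ, 0 < τ → IsEpiLike (C τ)) (hne : (innerLim C).Nonempty) :
    MoscoConverges (fun τ => polarEpi (C τ)) ∧
      innerLim (fun τ => EpiSens.polarEpi (C τ)) = EpiSens.polarEpi (innerLim C) := by
  have h1 := weakOuterLim_polarEpi_subset C
  have h2 := hM.polarEpi_innerLim_subset hC hne
  exact ⟨h1.trans h2, Subset.antisymm ((innerLim_subset_weakOuterLim _).trans h1) h2⟩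

end Mosco

/-! ### One-sided second-order Taylor expansion. -/

section Taylor

/-- Second-order Taylor expansion at an endpoint, for a function with vanishing first-order
expansion. -/
theorem TwiceDifferentiableAtZero.tendsto_div_sq {φ : ℝ → ℝ} (h : TwiceDifferentiableAtZero φ)
    (h0 : φ 0 = 0) (h1 : derivWithin φ (Ici 0) 0 = 0) :
    Tendsto (fun t => φ t / t ^ 2) (𝓝[>] 0)
      (𝓝 (1 / 2 * derivWithin (derivWithin φ (Ici 0)) (Ici 0) 0)) := by
  obtain ⟨hd, hdd⟩ := h
  have hsub : 𝓝[>] (0 : ℝ) ≤ 𝓝[≥] 0 := nhdsWithin_mono _ Ioi_subset_Ici_self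
  have hcont : Tendsto φ (𝓝[>] 0) (𝓝 0) := by
    have := (hd.self_of_nhdsWithin self_mem_Ici).continuousWithinAt.tendsto
    rw [h0] at this
    exact this.mono_left hsub
  have hder : ∀ᶠ t in 𝓝[>] (0 : ℝ), HasDerivAt φ (derivWithin φ (Ici 0) t) t := by
    filter_upwards [hsub hd, self_mem_nhdsWithin] with t ht ht0
    exact ht.hasDerivWithinAt.hasDerivAt (Ici_mem_nhds ht0)
  have hslope : Tendsto (fun t => derivWithin φ (Ici 0) t / t) (𝓝[>] 0)
      (𝓝 (derivWithin (derivWithin φ (Ici 0)) (Ici 0) 0)) := by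
    have := hasDerivWithinAt_iff_tendsto_slope.1 hdd.hasDerivWithinAt
    rw [Ici_sdiff_left] at this
    refine this.congr fun t => ?_
    rw [slope_def_field, h1, sub_zero, sub_zero]
  -- L'Hôpital is used only once: the second derivative exists only at `0`, where it is the limit of
  -- the slopes of the first.
  refine HasDerivAt.lhopital_zero_nhdsGT (g' := fun t => 2 * t) hder
    (Eventually.of_forall fun t => by simpa using hasDerivAt_pow 2 t) ?_ hcont ?_ ?_
  · filter_upwards [self_mem_nhdsWithin] with t ht
    exact mul_ne_zero two_ne_zero (ne_of_gt ht)
  · have : Tendsto (fun t : ℝ => t ^ 2) (𝓝 0) (𝓝 (0 ^ 2)) := (continuous_pow 2).tendsto 0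
    rw [zero_pow two_ne_zero] at this
    exact this.mono_left nhdsWithin_le_nhds
  · refine (hslope.const_mul (1 / 2)).congr fun t => ?_
    rw [div_mul_div_comm, one_mul]

end Taylor

/-! ### Adding constants, seen as vertical translation of epigraphs. -/

section VerticalShift

variable {H : Type*}

/-- The vertical translate of a set by `c`. -/
def verticalShift (C : Set (H × ℝ)) (c : ℝ) : Set (H × ℝ) :=
  {p | (p.1, p.2 - c) ∈ C}

theorem verticalShift_neg_cancel (C : Set (H × ℝ)) (c : ℝ) :
    verticalShift (verticalShift C (-c)) c = C := by
  ext p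
  simp [verticalShift]

theorem verticalShift_cancel_neg (C : Set (H × ℝ)) (c : ℝ) :
    verticalShift (verticalShift C c) (-c) = C := by
  ext p
  simp [verticalShift]

theorem epi_injective : Function.Injective (epi : (H → EReal) → Set (H × ℝ)) := by
  intro g h hgh
  funext w
  have key : ∀ r : ℝ, g w ≤ r ↔ h w ≤ r := fun r =>
    iff_of_eq (congrArg (fun S : Set (H × ℝ) => (w, r) ∈ S) hgh)
  exact le_antisymm (EReal.le_of_forall_lt_iff_le.1 fun r hr => (key r).2 hr.le)
    (EReal.le_of_forall_lt_iff_le.1 fun r hr => (key r).1 hr.le)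

theorem epi_add_coe (g : H → EReal) (c : ℝ) :
    epi (fun w => g w + (c : EReal)) = verticalShift (epi g) c := by
  ext p
  change g p.1 + (c : EReal) ≤ (p.2 : EReal) ↔ g p.1 ≤ ((p.2 - c : ℝ) : EReal)
  rw [EReal.coe_sub, EReal.le_sub_iff_add_le (Or.inl (EReal.coe_ne_bot c))
    (Or.inl (EReal.coe_ne_top c))]

variable [NormedAddCommGroup H] [InnerProductSpace ℝ H]

theorem polarEpi_verticalShift (C : Set (H × ℝ)) (c : ℝ) :
    polarEpi (verticalShift C c) = verticalShift (polarEpi C) (-c) := by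
  ext ⟨z, s⟩
  constructor
  · intro h p hp
    have := h (p.1, p.2 + c) (by simpa [verticalShift] using hp)
    simp only at this ⊢
    linarith
  · intro h p hp
    have := h _ hp
    simp only at this ⊢
    linarith

theorem IsEpiLike.verticalShift {C : Set (H × ℝ)} (hC : IsEpiLike C) (c : ℝ) :
    IsEpiLike (verticalShift C c) where
  isClosed := hC.isClosed.preimage (f := fun p : H × ℝ => (p.1, p.2 - c)) (by fun_prop)
  convex := by
    intro p hp q hq a b ha hb hab
    have h := hC.convex hp hq ha hb hab
    have h2 : a * p.2 + b * q.2 - c = a * (p.2 - c) + b * (q.2 - c) := by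
      linear_combination c * hab
    simpa [EpiSens.verticalShift, h2] using h
  nonempty := by
    obtain ⟨p, hp⟩ := hC.nonempty
    exact ⟨(p.1, p.2 + c), by simpa [EpiSens.verticalShift] using hp⟩
  upward := fun h hrs => hC.upward h (sub_le_sub_right hrs c)
  exists_notMem := fun w => by
    obtain ⟨r, hr⟩ := hC.exists_notMem w
    exact ⟨r + c, by simpa [EpiSens.verticalShift] using hr⟩

/-- Mosco convergence is stable under convergent vertical translations. -/
theorem MoscoConverges.verticalShift [CompleteSpace H] {S S' : ℝ → Set (H × ℝ)}
    (hM : MoscoConverges S) {c : ℝ → ℝ} {c₀ : ℝ} (hc : Tendsto c (𝓝[>] 0) (𝓝 c₀))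
    (hS : ∀ τ, 0 < τ → S' τ = verticalShift (S τ) (c τ)) :
    MoscoConverges S' ∧ innerLim S' = EpiSens.verticalShift (innerLim S) c₀ := by
  have hct : ∀ t, PosToZero t → Tendsto (fun n => c (t n)) atTop (𝓝 c₀) := fun t ht =>
    hc.comp (tendsto_nhdsWithin_iff.2 ⟨ht.2, Eventually.of_forall ht.1⟩)
  have h1 : weakOuterLim S' ⊆ EpiSens.verticalShift (weakOuterLim S) c₀ := by
    rintro ⟨a, r⟩ ⟨t, ht, u, hu, hmem⟩
    obtain ⟨h1, h2⟩ := (weakTendsto_prod_iff (u := fun n => (u n).1) (r := fun n => (u n).2)).1 hu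
    refine ⟨t, ht, fun n => ((u n).1, (u n).2 - c (t n)),
      weakTendsto_prod_iff.2 ⟨h1, h2.sub (hct t ht)⟩, fun n => ?_⟩
    have := hmem n
    rwa [hS _ (ht.1 n)] at this
  have h2 : EpiSens.verticalShift (innerLim S) c₀ ⊆ innerLim S' := by
    rintro ⟨a, r⟩ h t ht
    obtain ⟨u, hu, N, hN⟩ := h t ht
    refine ⟨fun n => ((u n).1, (u n).2 + c (t n)), ?_, N, fun n hn => ?_⟩
    · have h3 := ((continuous_fst.tendsto _).comp hu).prodMk_nhds
        (((continuous_snd.tendsto _).comp hu).add (hct t ht))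
      simpa using h3
    · rw [hS _ (ht.1 n)]
      simpa [EpiSens.verticalShift] using hN n hn
  have h3 : EpiSens.verticalShift (weakOuterLim S) c₀ ⊆ EpiSens.verticalShift (innerLim S) c₀ :=
    fun p hp => hM hp
  exact ⟨h1.trans (h3.trans h2),
    Subset.antisymm ((innerLim_subset_weakOuterLim _).trans (h1.trans h3)) h2⟩

end VerticalShift

/-! ### Difference quotients as affine preimages of epigraphs. -/

section Quotient

variable {H : Type*} [NormedAddCommGroup H] [InnerProductSpace ℝ H]

/-- The epigraph of the second-order difference quotient at `x` for `v`, with value `a` at `x`, of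
the function whose epigraph is `C`. -/
def quotientEpi (C : Set (H × ℝ)) (x v : H) (a τ : ℝ) : Set (H × ℝ) :=
  {p | (x + τ • p.1, a + τ * ⟪v, p.1⟫_ℝ + τ ^ 2 * p.2) ∈ C}

theorem IsEpiLike.quotientEpi {C : Set (H × ℝ)} (hC : IsEpiLike C) (x v : H) (a : ℝ) {τ : ℝ}
    (hτ : 0 < τ) : IsEpiLike (quotientEpi C x v a τ) where
  isClosed := hC.isClosed.preimage
    (f := fun p : H × ℝ => (x + τ • p.1, a + τ * ⟪v, p.1⟫_ℝ + τ ^ 2 * p.2)) (by fun_prop)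
  convex := by
    intro p hp q hq α β hα hβ hαβ
    have h := hC.convex hp hq hα hβ hαβ
    have h1 : x + τ • (α • p.1 + β • q.1) = α • (x + τ • p.1) + β • (x + τ • q.1) := by
      obtain rfl : β = 1 - α := by linarith
      module
    have h2 : a + τ * ⟪v, α • p.1 + β • q.1⟫_ℝ + τ ^ 2 * (α * p.2 + β * q.2) =
        α * (a + τ * ⟪v, p.1⟫_ℝ + τ ^ 2 * p.2) + β * (a + τ * ⟪v, q.1⟫_ℝ + τ ^ 2 * q.2) := by
      rw [inner_add_right, real_inner_smul_right, real_inner_smul_right]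
      linear_combination -a * hαβ
    change (x + τ • (α • p.1 + β • q.1),
      a + τ * ⟪v, α • p.1 + β • q.1⟫_ℝ + τ ^ 2 * (α * p.2 + β * q.2)) ∈ C
    rw [h1, h2]
    exact h
  nonempty := by
    obtain ⟨p, hp⟩ := hC.nonempty
    refine ⟨(τ⁻¹ • (p.1 - x), (p.2 - a - τ * ⟪v, τ⁻¹ • (p.1 - x)⟫_ℝ) / τ ^ 2), ?_⟩
    change (_, _) ∈ C
    rw [smul_inv_smul₀ hτ.ne', mul_div_cancel₀ _ (by positivity : τ ^ 2 ≠ 0)]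
    convert hp using 1
    ext <;> simp
  upward := fun h hrs => hC.upward h
    (by have := mul_le_mul_of_nonneg_left hrs (sq_nonneg τ); simpa using this)
  exists_notMem := fun w => by
    obtain ⟨r, hr⟩ := hC.exists_notMem (x + τ • w)
    refine ⟨(r - a - τ * ⟪v, w⟫_ℝ) / τ ^ 2, fun h => hr ?_⟩
    change (_, _) ∈ C at h
    rw [mul_div_cancel₀ _ (by positivity : τ ^ 2 ≠ 0)] at h
    convert h using 2
    ring

/-- Conjugation of second-order difference quotients. -/
theorem polarEpi_quotientEpi (C : Set (H × ℝ)) (x v : H) (a b : ℝ) {τ : ℝ} (hτ : 0 < τ) :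
    polarEpi (quotientEpi C x v a τ) =
      verticalShift (quotientEpi (polarEpi C) v x b τ) ((b + a - ⟪v, x⟫_ℝ) / τ ^ 2) := by
  have hτ2 : 0 < τ ^ 2 := by positivity
  ext ⟨z, s⟩
  constructor
  · intro h p hp
    -- The test point is the preimage of `p` under the affine map defining the quotient. The value
    -- `b` occurs in both the shift and the quotient on the right and cancels, so it is arbitrary.
    have h1 := h (τ⁻¹ • (p.1 - x), (p.2 - a - ⟪v, p.1 - x⟫_ℝ) / τ ^ 2) (by
      change (_, _) ∈ C
      rw [smul_inv_smul₀ hτ.ne', mul_div_cancel₀ _ hτ2.ne', real_inner_smul_right,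
        mul_inv_cancel_left₀ hτ.ne']
      convert hp using 1
      ext <;> simp)
    have h2 := mul_le_mul_of_nonneg_left h1 hτ2.le
    simp only [real_inner_smul_right, inner_sub_right] at h2
    rw [mul_add, mul_div_cancel₀ _ hτ2.ne'] at h2
    have h3 : τ ^ 2 * (τ⁻¹ * (⟪z, p.1⟫_ℝ - ⟪z, x⟫_ℝ)) = τ * (⟪z, p.1⟫_ℝ - ⟪z, x⟫_ℝ) := by
      field_simp
    rw [h3] at h2
    simp only [inner_add_left, real_inner_smul_left, mul_sub, mul_div_cancel₀ _ hτ2.ne']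
    rw [real_inner_comm z x]
    linarith
  · intro h p hp
    have h1 := h _ hp
    simp only [inner_add_left, inner_add_right, real_inner_smul_left, real_inner_smul_right,
      mul_sub, mul_div_cancel₀ _ hτ2.ne'] at h1
    rw [real_inner_comm z x] at h1
    simp only
    refine le_of_mul_le_mul_left ?_ hτ2
    linarith

end Quotient

/-! ### From epigraphs back to functions. -/

section Functions

variable {H : Type*} [NormedAddCommGroup H] [InnerProductSpace ℝ H]

theorem isEpiLike_epi_iff {g : H → EReal} : IsEpiLike (epi g) ↔ IsGammaZero g := by
  constructor
  · intro h
    refine ⟨fun w hw => ?_, ?_, h.isClosed, h.convex⟩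
    · obtain ⟨r, hr⟩ := h.exists_notMem w
      exact hr (by simp [epi, hw])
    · obtain ⟨p, hp⟩ := h.nonempty
      exact ⟨p.1, (lt_of_le_of_lt hp (EReal.coe_lt_top _)).ne⟩
  · intro h
    refine ⟨h.closed_epi, h.convex_epi, ?_, fun hw hrs => ?_, fun w => ?_⟩
    · obtain ⟨w, hw⟩ := h.proper
      obtain ⟨r, hr, -⟩ := EReal.lt_iff_exists_real_btwn.1 (lt_top_iff_ne_top.2 hw)
      exact ⟨(w, r), hr.le⟩
    · exact le_trans (show g _ ≤ _ from hw) (EReal.coe_le_coe_iff.2 hrs)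
    · obtain ⟨r, -, hr⟩ := EReal.lt_iff_exists_real_btwn.1 (bot_lt_iff_ne_bot.2 (h.ne_bot w))
      exact ⟨r, not_le.2 hr⟩

/-- Testing `g w` only against the reals above it suffices, so infinite values of `g` of either sign
are covered. -/
theorem conj_le_coe_iff {g : H → EReal} {z : H} {s : ℝ} :
    conj g z ≤ s ↔ ∀ p ∈ epi g, ⟪z, p.1⟫_ℝ ≤ p.2 + s := by
  rw [conj, iSup_le_iff]
  constructor
  · rintro h ⟨w, r⟩ hp
    have h1 := (EReal.sub_le_sub le_rfl hp).trans (h w)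
    rw [← EReal.coe_sub, EReal.coe_le_coe_iff] at h1
    simp only at h1 ⊢
    linarith
  · intro h w
    rw [EReal.sub_le_iff_le_add (Or.inr (EReal.coe_ne_top s)) (Or.inr (EReal.coe_ne_bot s)),
      add_comm, ← EReal.sub_le_iff_le_add (Or.inl (EReal.coe_ne_bot s))
        (Or.inl (EReal.coe_ne_top s)), ← EReal.coe_sub]
    refine EReal.le_of_forall_lt_iff_le.1 fun r hr => ?_
    have := h (w, r) hr.le
    simp only at this
    rw [EReal.coe_le_coe_iff]
    linarith

theorem epi_conj (g : H → EReal) : epi (conj g) = polarEpi (epi g) := by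
  ext p
  exact conj_le_coe_iff

theorem epi_secondQuotient {f : ℝ → H → EReal} {x : H} (v : H) {a τ : ℝ} (ha : f τ x = a)
    (hτ : 0 < τ) : epi (secondQuotient f x v τ) = quotientEpi (epi (f τ)) x v a τ := by
  ext ⟨w, r⟩
  have hτ2 : (0 : EReal) < ((τ ^ 2 : ℝ) : EReal) := by
    exact_mod_cast (by positivity : (0 : ℝ) < τ ^ 2)
  change (f τ (x + τ • w) - f τ x - ((τ * ⟪v, w⟫_ℝ : ℝ) : EReal)) / ((τ ^ 2 : ℝ) : EReal)
    ≤ (r : EReal) ↔ f τ (x + τ • w) ≤ ((a + τ * ⟪v, w⟫_ℝ + τ ^ 2 * r : ℝ) : EReal)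
  rw [EReal.div_le_iff_le_mul hτ2 (EReal.coe_ne_top _), ha,
    EReal.sub_le_iff_le_add (Or.inl (EReal.coe_ne_bot _)) (Or.inl (EReal.coe_ne_top _)),
    EReal.sub_le_iff_le_add (Or.inl (EReal.coe_ne_bot _)) (Or.inl (EReal.coe_ne_top _)),
    ← EReal.coe_mul, ← EReal.coe_add, ← EReal.coe_add]
  ring_nf

theorem conj_le_of_mem_subdifferential {g : H → EReal} {x v : H} {a : ℝ} (ha : g x = a)
    (hv : v ∈ subdifferential g x) : conj g v ≤ ((⟪v, x⟫_ℝ - a : ℝ) : EReal) := by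
  rw [conj_le_coe_iff]
  intro p hp
  have h1 := (hv p.1).trans (EReal.sub_le_sub hp le_rfl)
  rw [ha, ← EReal.coe_sub, EReal.coe_le_coe_iff, inner_sub_right] at h1
  linarith

theorem coe_le_conj {g : H → EReal} {x : H} {a : ℝ} (ha : g x = a) (z : H) :
    ((⟪z, x⟫_ℝ - a : ℝ) : EReal) ≤ conj g z := by
  refine le_trans (le_of_eq ?_) (le_iSup _ x)
  rw [ha, EReal.coe_sub]

/-- Equality in the Fenchel–Young inequality. -/
theorem conj_eq_of_mem_subdifferential {g : H → EReal} {x v : H} {a : ℝ} (ha : g x = a)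
    (hv : v ∈ subdifferential g x) : conj g v = ((⟪v, x⟫_ℝ - a : ℝ) : EReal) :=
  le_antisymm (conj_le_of_mem_subdifferential ha hv) (coe_le_conj ha v)

theorem mem_subdifferential_conj {g : H → EReal} {x v : H} {a : ℝ} (ha : g x = a)
    (hv : v ∈ subdifferential g x) : x ∈ subdifferential (conj g) v := by
  intro z
  rw [conj_eq_of_mem_subdifferential ha hv, EReal.le_sub_iff_add_le
    (Or.inl (EReal.coe_ne_bot _)) (Or.inl (EReal.coe_ne_top _)), ← EReal.coe_add]
  refine le_trans (le_of_eq ?_) (coe_le_conj ha z)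
  rw [inner_sub_right, real_inner_comm x z, real_inner_comm x v]
  congr 1
  ring

variable [CompleteSpace H]

/-- Transfer of M-convergence to families that are, up to convergent constants, the conjugates. -/
theorem MConverges.conj_shift {F G : ℝ → H → EReal} {c : ℝ → ℝ} {c₀ : ℝ}
    (hF : ∀ τ, 0 < τ → IsEpiLike (epi (F τ))) (hc : Tendsto c (𝓝[>] 0) (𝓝 c₀))
    (hG : ∀ τ, 0 < τ → epi (G τ) = verticalShift (polarEpi (epi (F τ))) (-c τ))
    (hM : MConverges F) (hL : IsGammaZero (mLim F)) :
    MConverges G ∧ IsGammaZero (mLim G) ∧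
      ∀ z, conj (mLim F) z = mLim G z + (c₀ : EReal) := by
  have hL' := isEpiLike_epi_iff.2 hL
  -- Properness of the M-limit supplies the nonempty inner limit that Mosco's theorem requires.
  obtain ⟨h1, h2⟩ := MoscoConverges.polarEpi hM hF (epi_mLim F ▸ hL'.nonempty)
  obtain ⟨h3, h4⟩ := h1.verticalShift hc.neg hG
  rw [h2, ← epi_mLim, ← epi_mLim] at h4
  refine ⟨h3, isEpiLike_epi_iff.1 (h4 ▸ hL'.polarEpi.verticalShift _), fun z => ?_⟩
  have h5 : EpiSens.conj (mLim F) = fun w => mLim G w + (c₀ : EReal) := epi_injective (by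
    rw [epi_conj, epi_add_coe, h4, verticalShift_neg_cancel])
  exact congrFun h5 z

theorem IsGammaZero.conj {g : H → EReal} (hg : IsGammaZero g) : IsGammaZero (conj g) := by
  rw [← isEpiLike_epi_iff, epi_conj]
  exact (isEpiLike_epi_iff.2 hg).polarEpi

end Functions

end EpiSens

theorem mainTheorem7 {H : Type*} [NormedAddCommGroup H] [InnerProductSpace ℝ H] [CompleteSpace H]
    (f : ℝ → H → EReal) (hf : EpiSens.IsParamGammaZero f)
    (x v : H) (hx : x ∈ EpiSens.finitePoints f)
    (hv : v ∈ EpiSens.subdifferential (f 0) x)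
    (hfin : v ∈ EpiSens.finitePoints (EpiSens.paramConj f))
    (hΦ : EpiSens.TwiceDifferentiableAtZero (EpiSens.dualityGap f x v))
    (hΦ' : derivWithin (EpiSens.dualityGap f x v) (Set.Ici 0) 0 = 0) :
    ((EpiSens.TwiceEpiDifferentiableAt f x v ∧
        EpiSens.IsGammaZero (EpiSens.secondEpiDeriv f x v)) ↔
      (EpiSens.TwiceEpiDifferentiableAt (EpiSens.paramConj f) v x ∧
        EpiSens.IsGammaZero (EpiSens.secondEpiDeriv (EpiSens.paramConj f) v x))) ∧
    ((EpiSens.TwiceEpiDifferentiableAt f x v ∧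
        EpiSens.IsGammaZero (EpiSens.secondEpiDeriv f x v)) →
      ∀ z : H, EpiSens.conj (EpiSens.secondEpiDeriv f x v) z =
        EpiSens.secondEpiDeriv (EpiSens.paramConj f) v x z +
          (((1 / 2 : ℝ) *
            derivWithin (derivWithin (EpiSens.dualityGap f x v) (Set.Ici 0)) (Set.Ici 0) 0 : ℝ) :
              EReal)) := by
  open EpiSens in
  have hfx : ∀ t, 0 ≤ t → f t x = ((f t x).toReal : EReal) := fun t ht =>
    (EReal.coe_toReal (hx t ht).2 (hx t ht).1).symm
  have hfv : ∀ t, 0 ≤ t → paramConj f t v = ((paramConj f t v).toReal : EReal) := fun t ht =>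
    (EReal.coe_toReal (hfin t ht).2 (hfin t ht).1).symm
  have hΦ0 : dualityGap f x v 0 = 0 := by
    have h := conj_eq_of_mem_subdifferential (hfx 0 le_rfl) hv
    change paramConj f 0 v = _ at h
    rw [dualityGap, h, EReal.toReal_coe]
    ring
  have hlim := hΦ.tendsto_div_sq hΦ0 hΦ'
  have hF : ∀ τ, 0 < τ → epi (secondQuotient f x v τ) =
      quotientEpi (epi (f τ)) x v (f τ x).toReal τ := fun τ hτ =>
    epi_secondQuotient v (hfx τ hτ.le) hτ
  have hG : ∀ τ, 0 < τ → epi (secondQuotient (paramConj f) v x τ) =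
      quotientEpi (polarEpi (epi (f τ))) v x (paramConj f τ v).toReal τ := fun τ hτ => by
    rw [epi_secondQuotient x (hfv τ hτ.le) hτ, paramConj, epi_conj]
  have hFE : ∀ τ, 0 < τ → IsEpiLike (epi (secondQuotient f x v τ)) := fun τ hτ => by
    rw [hF τ hτ]
    exact (isEpiLike_epi_iff.2 (hf τ hτ.le)).quotientEpi x v _ hτ
  have hGE : ∀ τ, 0 < τ → IsEpiLike (epi (secondQuotient (paramConj f) v x τ)) := fun τ hτ => by
    rw [hG τ hτ]
    exact (isEpiLike_epi_iff.2 (hf τ hτ.le)).polarEpi.quotientEpi v x _ hτ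
  have hpol : ∀ τ, 0 < τ → polarEpi (epi (secondQuotient f x v τ)) = verticalShift
      (epi (secondQuotient (paramConj f) v x τ)) (dualityGap f x v τ / τ ^ 2) := fun τ hτ => by
    rw [hF τ hτ, hG τ hτ]
    exact polarEpi_quotientEpi _ x v _ _ hτ
  have hGF : ∀ τ, 0 < τ → epi (secondQuotient (paramConj f) v x τ) = verticalShift
      (polarEpi (epi (secondQuotient f x v τ))) (-(dualityGap f x v τ / τ ^ 2)) := fun τ hτ => by
    rw [hpol τ hτ, verticalShift_cancel_neg]
  have hFG : ∀ τ, 0 < τ → epi (secondQuotient f x v τ) = verticalShift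
      (polarEpi (epi (secondQuotient (paramConj f) v x τ)))
      (-(dualityGap f x v τ / τ ^ 2)) := fun τ hτ => by
    -- Moving the shift inside the polar flips its sign, after which biconjugation applies; hence
    -- the same constants `Φ(τ)/τ²` serve in both directions.
    rw [← polarEpi_verticalShift, ← hpol τ hτ, (hFE τ hτ).polarEpi_polarEpi]
  refine ⟨⟨fun ⟨h1, h2⟩ => ?_, fun ⟨h1, h2⟩ => ?_⟩, fun ⟨h1, h2⟩ => ?_⟩
  · obtain ⟨h3, h4, -⟩ := MConverges.conj_shift hFE hlim hGF h1.mConverges h2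
    exact ⟨⟨fun t ht => (hf t ht).conj, hfin, mem_subdifferential_conj (hfx 0 le_rfl) hv, h3⟩, h4⟩
  · obtain ⟨h3, h4, -⟩ := MConverges.conj_shift hGE hlim hFG h1.mConverges h2
    exact ⟨⟨hf, hx, hv, h3⟩, h4⟩
  · exact (MConverges.conj_shift hFE hlim hGF h1.mConverges h2).2.2
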